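/- Let $F$ be a field and let $K$ be an algebraically closed extension field of $F$ (for example $K=F$ if $F$ is algebraically closed). A variety is a reduced separated scheme of finite type over $F$, and points are $K$-points. An ind-variety $X=\varinjlim X_n$ is given by a sequence of closed embeddings of varieties $X_0\hookrightarrow X_1\hookrightarrow\cdots$; its set of points is $X(K)=\bigcup_n X_n(K)$. An ind-morphism $X\to Y$ is a compatible collection of morphisms $X_n\to Y_{n'}$ over $F$, where $n'$ depends on $n$. Two sequences are equivalent if they give isomorphic ind-varieties, and $X$ is irreducible if it is equivalent to an ind-variety $\varinjlim Y_n$ with all $Y_n$ irreducible. An ind-group is an ind-variety $G$ with a group structure on its set of points such that the multiplication $G\times G\to G$ and the inverse are ind-morphisms, where $X\times Y=\varinjlim X_n\times Y_n$. An action of $G$ on $X$ is regular if $G\times X\to X$ is an ind-morphism. An open ind-subvariety $U\subset X$ is an ind-variety $U=\varinjlim U_n$ with compatible open embeddings $U_n\subset X_n$. Consider a regular action of an ind-group $G$ on an irreducible ind-variety $X$. Let $U,U'\subset X$ be non-empty open ind-subvarieties, and let $\pi\colon U\to Z$ and $\pi'\colon U'\to Z'$ be morphisms to varieties $Z$, $Z'$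 such that, for every point $z$ of $Z$ (respectively of $Z'$), the fiber of $\pi$ (respectively of $\pi'$) over $z$ is a $G$-orbit in $X$ (in particular, it is non-empty). Then $\dim Z=\dim Z'$. Consequently the generic modality is well defined: say that the action is of generic modality $k\in\mathbb{Z}_{\ge 0}$ if there are an open ind-subvariety $U\subset X$ and a morphism $\pi\colon U\to Z$ to a variety $Z$ of dimension $k$ such that the fiber over every point of $Z$ is a $G$-orbit. If the action is of generic modality $k$ and also of generic modality $k'$, then $k=k'$. -/

import Mathlib

open CategoryTheory CategoryTheory.Limits AlgebraicGeometry

universe u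

/-- An algebraic variety over a field `F`: a reduced separated scheme of finite type over `F`
(not necessarily irreducible). -/
structure IsVariety {F : Type u} [Field F] (Z : Over (Spec (CommRingCat.of F))) : Prop where
  isReduced : IsReduced Z.left
  isSeparated : IsSeparated Z.hom
  locallyOfFiniteType : LocallyOfFiniteType Z.hom
  quasiCompact : QuasiCompact Z.hom

/-- The dimension of a variety, that is, the Krull dimension of its underlying space
(the empty variety has dimension `⊥`). -/
noncomputable def varietyDim {F : Type u} [Field F] (Z : Over (Spec (CommRingCat.of F))) :
    WithBot ℕ∞ :=
  topologicalKrullDim Z.left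

/-- An ind-variety over `F`, given by a sequence `X₀ ↪ X₁ ↪ X₂ ↪ ⋯` of closed embeddings of
varieties over `F`. -/
structure IndVariety (F : Type u) [Field F] where
  /-- the sequence of varieties and transition maps -/
  seq : ℕ ⥤ Over (Spec (CommRingCat.of F))
  isVariety : ∀ n, IsVariety (seq.obj n)
  isClosedImmersion : ∀ n, IsClosedImmersion (seq.map (homOfLE (Nat.le_succ n))).left

/-- `Spec K` as a scheme over `F`, for a field extension `K` of `F`. -/
noncomputable def specOver (F K : Type u) [Field F] [Field K] [Algebra F K] :
    Over (Spec (CommRingCat.of F)) :=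
  Over.mk (Spec.map (CommRingCat.ofHom (algebraMap F K)))

namespace IndVariety

variable {F : Type u} [Field F]

/-- The set `X(K) = ⋃ₙ Xₙ(K)` of `K`-points of an ind-variety, as the direct limit of the
sets `Xₙ(K)`. -/
def Point (K : Type u) [Field K] [Algebra F K] (X : IndVariety F) : Type u :=
  colimit (X.seq ⋙ coyoneda.obj (Opposite.op (specOver F K)))

variable {K : Type u} [Field K] [Algebra F K]

/-- The map `Xₙ(K) → X(K)`. -/
noncomputable def toPoint (X : IndVariety F) (n : ℕ) (p : specOver F K ⟶ X.seq.obj n) :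
    X.Point K :=
  colimit.ι (X.seq ⋙ coyoneda.obj (Opposite.op (specOver F K))) n p

/-- A map `φ : X(K) → Y(K)` is an ind-morphism if for each `n` there are `n'` and a morphism
`φₙ : Xₙ → Yₙ'` of varieties over `F` which induces the restriction of `φ` to `Xₙ(K)`.
(When `K` is algebraically closed, the `φₙ` are determined by `φ` up to enlarging `n'`, and so
they are compatible with each other.) -/
def IsIndMorphism {X Y : IndVariety F} (φ : X.Point K → Y.Point K) : Prop :=
  ∀ n, ∃ (n' : ℕ) (f : X.seq.obj n ⟶ Y.seq.obj n'),
    ∀ p : specOver F K ⟶ X.seq.obj n, φ (X.toPoint n p) = Y.toPoint n' (p ≫ f)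

/-- The product `V × W` over `F`. -/
noncomputable def prodOver (V W : Over (Spec (CommRingCat.of F))) :
    Over (Spec (CommRingCat.of F)) :=
  Over.mk (pullback.fst V.hom W.hom ≫ V.hom)

/-- The first projection `V × W → V`. -/
noncomputable def prodFst (V W : Over (Spec (CommRingCat.of F))) : prodOver V W ⟶ V :=
  Over.homMk (pullback.fst V.hom W.hom) rfl

/-- The second projection `V × W → W`. -/
noncomputable def prodSnd (V W : Over (Spec (CommRingCat.of F))) : prodOver V W ⟶ W :=
  Over.homMk (pullback.snd V.hom W.hom) pullback.condition.symm

/-- A map `φ : X(K) × Y(K) → Z(K)` (written in curried form) is an ind-morphism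
`X × Y = lim Xₙ × Yₙ → Z` if for each `n` there are `n'` and a morphism `Xₙ × Yₙ → Zₙ'` over `F`
which induces the restriction of `φ` to `Xₙ(K) × Yₙ(K)`. -/
def IsIndMorphism₂ {X Y Z : IndVariety F} (φ : X.Point K → Y.Point K → Z.Point K) : Prop :=
  ∀ n, ∃ (n' : ℕ) (f : prodOver (X.seq.obj n) (Y.seq.obj n) ⟶ Z.seq.obj n'),
    ∀ p : specOver F K ⟶ prodOver (X.seq.obj n) (Y.seq.obj n),
      φ (X.toPoint n (p ≫ prodFst _ _)) (Y.toPoint n (p ≫ prodSnd _ _)) = Z.toPoint n' (p ≫ f)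

variable (K)

/-- Two sequences define the same ind-variety (up to identification of the points): there is a
bijection of the points which is an ind-morphism in both directions. -/
def IsEquivalent (X Y : IndVariety F) : Prop :=
  ∃ e : X.Point K ≃ Y.Point K,
    IsIndMorphism (fun x => e x) ∧ IsIndMorphism (fun y => e.symm y)

/-- An ind-variety is irreducible if, up to an equivalence, all the members of its sequence are
irreducible. -/
def IsIrreducible (X : IndVariety F) : Prop :=
  ∃ Y : IndVariety F, IsEquivalent K X Y ∧ ∀ n, IrreducibleSpace (Y.seq.obj n).left

/-- A group structure on the points of an ind-variety `G` makes it an ind-group if the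
multiplication and the inverse are ind-morphisms. -/
structure IsIndGroup (G : IndVariety F) [Group (G.Point K)] : Prop where
  mul : IsIndMorphism₂ (fun g h : G.Point K => g * h)
  inv : IsIndMorphism (fun g : G.Point K => g⁻¹)

/-- An action of `G` on `X` is regular if the action map `G × X → X` is an ind-morphism. -/
def IsRegularAction (G X : IndVariety F) [Group (G.Point K)]
    [MulAction (G.Point K) (X.Point K)] : Prop :=
  IsIndMorphism₂ (fun (g : G.Point K) (x : X.Point K) => g • x)

/-- An open ind-subvariety of `X = lim Xₙ`: an ind-variety `U = lim Uₙ` with compatible open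
embeddings `Uₙ ⊆ Xₙ`. -/
structure OpenIndSubvariety (X : IndVariety F) extends IndVariety F where
  /-- the inclusions `Uₙ → Xₙ` -/
  incl : seq ⟶ X.seq
  isOpenImmersion : ∀ n, IsOpenImmersion (incl.app n).left

/-- A morphism from an ind-variety `U = lim Uₙ` to a scheme `Z` over `F`: a compatible collection
of morphisms `Uₙ → Z`. -/
abbrev HomTo (U : IndVariety F) (Z : Over (Spec (CommRingCat.of F))) :=
  U.seq ⟶ (Functor.const ℕ).obj Z

variable {K}

/-- The fiber over `z ∈ Z(K)` of a morphism `π : U → Z` on an open ind-subvariety `U` of `X`,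
as a subset of `X(K)`. -/
def fiber {X : IndVariety F} {U : OpenIndSubvariety X} {Z : Over (Spec (CommRingCat.of F))}
    (π : HomTo U.toIndVariety Z) (z : specOver F K ⟶ Z) : Set (X.Point K) :=
  {x | ∃ (n : ℕ) (p : specOver F K ⟶ U.seq.obj n),
    p ≫ π.app n = z ∧ X.toPoint n (p ≫ U.incl.app n) = x}

variable (K)

/-- The fibers of `π : U → Z` are `G`-orbits: the fiber over every point of `Z` is an orbit. In
particular every fiber is non-empty, and `U` is a union of orbits. -/
def FibersAreOrbits (G : IndVariety F) {X : IndVariety F} [Group (G.Point K)]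
    [MulAction (G.Point K) (X.Point K)] {U : OpenIndSubvariety X}
    {Z : Over (Spec (CommRingCat.of F))} (π : HomTo U.toIndVariety Z) : Prop :=
  ∀ z : specOver F K ⟶ Z, ∃ x : X.Point K, fiber π z = MulAction.orbit (G.Point K) x

/-- The action of `G` on `X` is of generic modality `k`: there are an open ind-subvariety `U` of
`X` and a morphism from `U` to a variety of dimension `k` whose fibers are `G`-orbits. -/
def HasGenericModality (G X : IndVariety F) [Group (G.Point K)]
    [MulAction (G.Point K) (X.Point K)] (k : ℕ) : Prop :=
  ∃ (U : OpenIndSubvariety X) (Z : Over (Spec (CommRingCat.of F))) (π : HomTo U.toIndVariety Z),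
    IsVariety Z ∧ varietyDim Z = k ∧ FibersAreOrbits K G π

end IndVariety

/-! By symmetry it suffices that dim Z ≤ dim Z'. Pass to an equivalent sequence of irreducible Y_k
and let W_k ⊂ Y_k be the preimage of U ∩ U'. On K-points of W_k the map to Z' determines the map to
Z: a fiber of π' is one orbit, and π is constant on an orbit that meets U
(`FibersAreOrbits.comp_app_eq`).

The images in Z of the generic points of the W_k successively generize, so they stabilize by
noetherianity. Every nonempty open subset of Z meets the image of some W_k, hence a single W_n
already dominates Z (`varietyDim_le_of_sequence`).

There remains a statement on varieties (`varietyDim_le_of_dominant`). In affine charts let a be a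
function on Z pulled back to W. Then a ⊗ 1 - 1 ⊗ a vanishes at every K-point of W ×_{Z'} W, so it is
nilpotent by the Nullstellensatz, and this forces a to be algebraic over the functions coming from
Z' (`isAlgebraic_of_forall_algHom`), in any characteristic. Noether normalization turns algebraicity
into the inequality of dimensions. -/

/-! ### Commutative algebra: K-points, algebraicity and Krull dimension. -/

theorem Algebra.FiniteType.nonempty_algHom (F K C : Type*) [Field F] [Field K] [Algebra F K]
    [IsAlgClosed K] [CommRing C] [Algebra F C] [Algebra.FiniteType F C] [Nontrivial C] :
    Nonempty (C →ₐ[F] K) := by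
  obtain ⟨m, hm⟩ := Ideal.exists_maximal C
  let _ := Ideal.Quotient.field m
  have : Module.Finite F (C ⧸ m) := finite_of_finite_type_of_isJacobsonRing F (C ⧸ m)
  exact ⟨(IsAlgClosed.lift : C ⧸ m →ₐ[F] K).comp (Ideal.Quotient.mkₐ F m)⟩

/-- Rabinowitsch trick: otherwise the localization at `c` is nonzero and has a K-point, at which `c`
is a unit. -/
theorem isNilpotent_of_forall_algHom (F K : Type*) {C : Type*} [Field F] [Field K] [Algebra F K]
    [IsAlgClosed K] [CommRing C] [Algebra F C] [Algebra.FiniteType F C] (c : C)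
    (h : ∀ f : C →ₐ[F] K, f c = 0) : IsNilpotent c := by
  by_contra hc
  have : Nontrivial (Localization.Away c) := by
    by_contra hn
    rw [not_nontrivial_iff_subsingleton] at hn
    obtain ⟨⟨_, n, rfl⟩, hn⟩ := (IsLocalization.map_eq_zero_iff (Submonoid.powers c)
      (Localization.Away c) 1).1 (Subsingleton.elim _ _)
    exact hc ⟨n, by simpa using hn⟩
  have : Algebra.FiniteType C (Localization.Away c) :=
    IsLocalization.finiteType_of_monoid_fg (Submonoid.powers c) _
  have : Algebra.FiniteType F (Localization.Away c) := .trans ‹_› this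
  obtain ⟨f⟩ := Algebra.FiniteType.nonempty_algHom F K (Localization.Away c)
  have hu := (IsLocalization.Away.algebraMap_isUnit (S := Localization.Away c) c).map f
  have := h (f.comp (IsScalarTower.toAlgHom F C (Localization.Away c)))
  simp only [AlgHom.comp_apply, IsScalarTower.coe_toAlgHom'] at this
  exact hu.ne_zero this

theorem ringKrullDim_le_of_isIntegral (R S : Type*) [CommRing R] [CommRing S] [Algebra R S]
    [Algebra.IsIntegral R S] : ringKrullDim S ≤ ringKrullDim R :=
  Order.krullDim_le_of_strictMono (PrimeSpectrum.comap (algebraMap R S))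
    fun _ _ h => Ideal.IsIntegral.comap_lt_comap h

theorem ringKrullDim_le_of_isIntegral_of_injective (R S : Type*) [CommRing R] [CommRing S]
    [Algebra R S] [Algebra.IsIntegral R S] [FaithfulSMul R S] :
    ringKrullDim R ≤ ringKrullDim S := by
  refine iSup_le fun l => ?_
  obtain ⟨Q, -, hQ, hQl⟩ := Ideal.exists_ideal_over_prime_of_isIntegral (S := S)
    l.head.asIdeal ⊥ (by
      rw [← RingHom.ker_eq_comap_bot, (RingHom.injective_iff_ker_eq_bot _).1
        (FaithfulSMul.algebraMap_injective R S)]; exact bot_le)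
  have : Q.LiesOver l.head.asIdeal := ⟨hQl.symm⟩
  obtain ⟨M, hM, -⟩ := Ideal.exists_ltSeries_of_hasGoingUp l Q
  rw [← hM]
  exact Order.LTSeries.length_le_krullDim M

theorem Transcendental.linearIndependent_pow {A B : Type*} [CommRing A] [CommRing B] [Algebra A B]
    {a : B} (ha : Transcendental A a) : LinearIndependent A (fun i : ℕ => a ^ i) := by
  have := (Polynomial.basisMonomials A).linearIndependent.map' (Polynomial.aeval a).toLinearMap
    (LinearMap.ker_eq_bot.2 (transcendental_iff_injective.1 ha))
  simpa [Function.comp_def, Polynomial.aeval_monomial] using this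

open TensorProduct in
theorem isAlgebraic_of_isNilpotent_tmul_sub {A B : Type*} [CommRing A] [IsDomain A] [CommRing B]
    [Algebra A B] (a : B) (h : IsNilpotent (a ⊗ₜ[A] (1 : B) - (1 : B) ⊗ₜ[A] a)) :
    IsAlgebraic A a := by
  by_contra ha
  obtain ⟨n, hn⟩ := h
  have hli := Transcendental.linearIndependent_pow ha
  have hli2 := hli.tmul_of_isDomain hli
  rw [sub_eq_add_neg, (Commute.all _ _).add_pow'] at hn
  -- The binomial expansion is a linear relation among the a^i ⊗ a^j; its coefficient at (n, 0) is
  -- 1.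
  have := linearIndependent_iff'.1 hli2 (Finset.HasAntidiagonal.antidiagonal n)
    (fun m => (n.choose m.1 : A) * (-1) ^ m.2) (by
      rw [← hn]
      refine Finset.sum_congr rfl fun m _ => ?_
      rw [neg_pow (1 ⊗ₜ[A] a : B ⊗[A] B), Algebra.TensorProduct.tmul_pow,
        Algebra.TensorProduct.tmul_pow, one_pow, one_pow]
      obtain hm | hm := Nat.even_or_odd m.2 <;>
      simp [hm.neg_one_pow, Nat.cast_smul_eq_nsmul]) (n, 0) (by simp)
  simp at this

/-- A K-point of `B ⊗[A] B` is a pair of K-points of `B` that agree on `A`. -/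
theorem isAlgebraic_of_forall_algHom (F K : Type*) {A B : Type*} [Field F] [Field K] [Algebra F K]
    [IsAlgClosed K] [CommRing A] [CommRing B] [IsDomain A] [Algebra F A] [Algebra F B]
    [Algebra A B] [IsScalarTower F A B] [Algebra.FiniteType F B] (a : B)
    (h : ∀ f g : B →ₐ[F] K, (∀ x, f (algebraMap A B x) = g (algebraMap A B x)) → f a = g a) :
    IsAlgebraic A a := by
  have : Algebra.FiniteType A B := .of_restrictScalars_finiteType F A B
  have : Algebra.FiniteType F (TensorProduct A B B) := .trans (S := B) ‹_› inferInstance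
  refine isAlgebraic_of_isNilpotent_tmul_sub a (isNilpotent_of_forall_algHom F K _ fun ψ => ?_)
  have := h (ψ.comp ((Algebra.TensorProduct.includeLeft : B →ₐ[A] _).restrictScalars F))
    (ψ.comp ((Algebra.TensorProduct.includeRight : B →ₐ[A] _).restrictScalars F)) (fun x => by
      simp [Algebra.TensorProduct.tmul_one_eq_one_tmul])
  simpa [sub_eq_zero] using this

/-- The `x i` lie in the algebraic closure of `P` in `B`, which has the same transcendence degree
over `F` as `P`. -/
theorem AlgebraicIndependent.le_trdeg_of_isAlgebraic {F P B : Type u} [Field F] [CommRing P]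
    [CommRing B] [IsDomain P] [IsDomain B] [Algebra F P] [Algebra F B] [Algebra P B]
    [IsScalarTower F P B] [FaithfulSMul P B] {d : ℕ} {x : Fin d → B}
    (hx : AlgebraicIndependent F x) (h : ∀ i, IsAlgebraic P (x i)) :
    (d : Cardinal) ≤ Algebra.trdeg F P := by
  let C := Subalgebra.algebraicClosure P B
  let x' : Fin d → C := fun i => ⟨x i, h i⟩
  have hx' : AlgebraicIndependent F x' :=
    AlgebraicIndependent.of_comp (C.val.restrictScalars F) hx
  have h1 := hx'.lift_cardinalMk_le_trdeg
  have h2 := trdeg_add_eq F P (A := C)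
  rw [trdeg_eq_zero (R := P), add_zero] at h2
  rw [h2]
  simpa using h1

theorem ringKrullDim_le_of_forall_algHom (F K : Type u) {A A' B : Type u} [Field F] [Field K]
    [Algebra F K] [IsAlgClosed K] [CommRing A] [CommRing A'] [CommRing B] [IsDomain B]
    [Algebra F A] [Algebra F A'] [Algebra F B] [Algebra.FiniteType F A] [Algebra.FiniteType F A']
    [Algebra.FiniteType F B] (φ : A →ₐ[F] B) (hφ : Function.Injective φ) (φ' : A' →ₐ[F] B)
    (h : ∀ f g : B →ₐ[F] K, f.comp φ' = g.comp φ' → f.comp φ = g.comp φ) :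
    ringKrullDim A ≤ ringKrullDim A' := by
  have : Nontrivial A := by
    by_contra hn
    rw [not_nontrivial_iff_subsingleton] at hn
    exact zero_ne_one (α := B) (by rw [← map_one φ, Subsingleton.elim (1 : A) 0, map_zero])
  have : Algebra.FiniteType F φ'.range := .of_surjective φ'.rangeRestrict φ'.rangeRestrict_surjective
  have halg (a : A) : IsAlgebraic φ'.range (φ a) :=
    isAlgebraic_of_forall_algHom F K _ fun f g hfg => DFunLike.congr_fun (h f g
      (AlgHom.ext fun x => hfg ⟨φ' x, x, rfl⟩)) a
  obtain ⟨d, g, hg, hgi⟩ := exists_integral_inj_algHom_of_fg F A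
  -- `φ'` need not be injective, so its image is normalized in place of `A'`; passing to a quotient
  -- of `A'` does not raise the dimension.
  obtain ⟨e, g', hg', hgi'⟩ := exists_integral_inj_algHom_of_fg F φ'.range
  let ψ : MvPolynomial (Fin e) F →ₐ[F] B := φ'.range.val.comp g'
  algebraize [g.toRingHom, g'.toRingHom, ψ.toRingHom]
  have : FaithfulSMul (MvPolynomial (Fin e) F) φ'.range :=
    (faithfulSMul_iff_algebraMap_injective _ _).2 hg'
  have : FaithfulSMul (MvPolynomial (Fin e) F) B :=
    (faithfulSMul_iff_algebraMap_injective _ _).2 (Subtype.val_injective.comp hg')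
  have : IsScalarTower (MvPolynomial (Fin e) F) φ'.range B := .of_algebraMap_eq fun _ => rfl
  have : IsScalarTower F (MvPolynomial (Fin e) F) B :=
    .of_algebraMap_eq fun r => (ψ.commutes r).symm
  have hx : AlgebraicIndependent F fun i => φ (g (MvPolynomial.X i)) := by
    have := (MvPolynomial.algebraicIndependent_X (Fin d) F).map' (f := φ.comp g) (hφ.comp hg)
    exact this
  have hde : d ≤ e := by
    have := hx.le_trdeg_of_isAlgebraic (P := MvPolynomial (Fin e) F) fun i =>
      (halg _).restrictScalars _
    simpa using this
  calc ringKrullDim A ≤ ringKrullDim (MvPolynomial (Fin d) F) := ringKrullDim_le_of_isIntegral _ _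
    _ = d := by simp
    _ ≤ e := by exact_mod_cast hde
    _ = ringKrullDim (MvPolynomial (Fin e) F) := by simp
    _ ≤ ringKrullDim φ'.range := ringKrullDim_le_of_isIntegral_of_injective _ _
    _ ≤ ringKrullDim A' := ringKrullDim_le_of_surjective φ'.rangeRestrict.toRingHom
        φ'.rangeRestrict_surjective

/-! ### Schemes over F: generizations, affine charts, dimension under dominant maps. -/

/-- A sequence of points of a locally noetherian scheme, each of which generizes its predecessor,
is eventually constant. -/
theorem exists_forall_eq_of_specializes {Z : Scheme.{u}} [IsLocallyNoetherian Z] (c : ℕ → Z)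
    (hc : ∀ k, c (k + 1) ⤳ c k) : ∃ n, ∀ m, n ≤ m → c m = c n := by
  have hc' : ∀ k, c k ⤳ c 0 := fun k => by
    induction k with
    | zero => exact specializes_rfl
    | succ k ih => exact (hc k).trans ih
  obtain ⟨V, hV, hcV, -⟩ := exists_isAffineOpen_mem_and_subset (U := ⊤) (x := c 0) trivial
  have hmem (k) : c k ∈ Set.range hV.fromSpec := by
    rw [hV.range_fromSpec]
    exact (hc' k).mem_open V.2 hcV
  choose p hp using hmem
  have hemb := hV.fromSpec.isOpenEmbedding
  have : IsNoetherianRing Γ(Z, V) := IsLocallyNoetherian.component_noetherian ⟨V, hV⟩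
  have hle (k) : (p (k + 1)).asIdeal ≤ (p k).asIdeal := by
    have : p (k + 1) ⤳ p k := by
      rw [← hemb.isInducing.specializes_iff, hp, hp]; exact hc k
    exact (PrimeSpectrum.le_iff_specializes _ _).2 this
  have hanti : Antitone fun k => (p k).asIdeal := antitone_nat_of_succ_le hle
  -- Heights of a decreasing sequence of primes stabilize; being finite in a noetherian ring, they
  -- would drop at any strict inclusion.
  obtain ⟨n, hn⟩ := WellFoundedLT.antitone_chain_condition
    (f := fun k => (p k).asIdeal.height) (fun a b h => Ideal.height_mono (hanti h))
  refine ⟨n, fun m hm => ?_⟩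
  rw [← hp, ← hp]
  congr 1
  by_contra hne
  have hlt : (p m).asIdeal < (p n).asIdeal :=
    lt_of_le_of_ne (hanti hm) fun h => hne (PrimeSpectrum.ext h)
  have : (p m).asIdeal.IsPrime := (p m).2
  exact (Ideal.height_strict_mono_of_isPrime hlt).ne (hn m hm).symm

/-- The spectrum of an `F`-algebra, as a scheme over `F`. -/
noncomputable abbrev affineOver (F A : Type u) [Field F] [CommRing A] [Algebra F A] :
    Over (Spec (CommRingCat.of F)) :=
  Over.mk (Spec.map (CommRingCat.ofHom (algebraMap F A)))

/-- The morphism of spectra induced by a homomorphism of `F`-algebras. -/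
noncomputable def affineOverMap {F A B : Type u} [Field F] [CommRing A] [Algebra F A] [CommRing B]
    [Algebra F B] (φ : A →ₐ[F] B) : affineOver F B ⟶ affineOver F A :=
  Over.homMk (Spec.map (CommRingCat.ofHom φ.toRingHom)) (by
    simp [← Spec.map_comp, ← CommRingCat.ofHom_comp])

theorem affineOverMap_comp {F A B C : Type u} [Field F] [CommRing A] [Algebra F A] [CommRing B]
    [Algebra F B] [CommRing C] [Algebra F C] (φ : A →ₐ[F] B) (ψ : B →ₐ[F] C) :
    affineOverMap (ψ.comp φ) = affineOverMap ψ ≫ affineOverMap φ := by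
  ext1
  exact Spec.map_comp (CommRingCat.ofHom φ.toRingHom) (CommRingCat.ofHom ψ.toRingHom)

theorem affineOverMap_injective {F A B : Type u} [Field F] [CommRing A] [Algebra F A] [CommRing B]
    [Algebra F B] : Function.Injective (affineOverMap : (A →ₐ[F] B) → _) := by
  intro φ ψ h
  have := Spec.map_injective (congrArg CommaMorphism.left h)
  ext x
  exact congr($this x)

theorem affineOverMap_surjective {F A B : Type u} [Field F] [CommRing A] [Algebra F A] [CommRing B]
    [Algebra F B] : Function.Surjective (affineOverMap : (A →ₐ[F] B) → _) := by
  intro f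
  obtain ⟨φ, hφ⟩ := Spec.map_surjective f.left
  have h := Over.w f
  rw [← hφ] at h
  simp only [Over.mk_hom, Over.mk_left] at h
  have h' := Spec.map_injective ((Spec.map_comp _ _).trans h)
  refine ⟨⟨φ.hom, fun r => congr($h' r)⟩, ?_⟩
  ext1
  exact hφ

theorem exists_affineOver {F : Type u} [Field F] (Z : Over (Spec (CommRingCat.of F)))
    [LocallyOfFiniteType Z.hom] {x : Z.left} {N : Z.left.Opens} (hx : x ∈ N) :
    ∃ (A : Type u) (_ : CommRing A) (_ : Algebra F A) (j : affineOver F A ⟶ Z),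
      Algebra.FiniteType F A ∧ IsOpenImmersion j.left ∧ x ∈ Set.range j.left ∧
        Set.range j.left ⊆ N := by
  obtain ⟨R, f, hf, hxf, hfN⟩ := Scheme.exists_affine_mem_range_and_range_subset hx
  obtain ⟨i, hi⟩ := Spec.map_surjective (f ≫ Z.hom)
  let _ : Algebra F R := i.hom.toAlgebra
  have hi' : CommRingCat.ofHom (algebraMap F R) = i := rfl
  refine ⟨R, inferInstance, i.hom.toAlgebra, Over.homMk f hi.symm, ?_, hf, hxf, hfN⟩
  have : LocallyOfFiniteType (Spec.map i) := hi ▸ inferInstance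
  exact HasRingHomProperty.Spec_iff.1 this

theorem ringKrullDim_le_varietyDim {F : Type u} [Field F] {Z : Over (Spec (CommRingCat.of F))}
    {A : Type u} [CommRing A] [Algebra F A] (j : affineOver F A ⟶ Z) [IsOpenImmersion j.left] :
    ringKrullDim A ≤ varietyDim Z := by
  rw [← PrimeSpectrum.topologicalKrullDim_eq_ringKrullDim]
  exact j.left.isOpenEmbedding.isInducing.topologicalKrullDim_le

/-- A chain of irreducible closed sets is visible in any chart around a point of its smallest
member, since coheight is unchanged on an open set that meets it. -/
theorem varietyDim_le {F : Type u} [Field F] {Z : Over (Spec (CommRingCat.of F))}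
    [LocallyOfFiniteType Z.hom] {d : WithBot ℕ∞}
    (h : ∀ (A : Type u) [CommRing A] [Algebra F A] (j : affineOver F A ⟶ Z),
      Algebra.FiniteType F A → IsOpenImmersion j.left → Nontrivial A → ringKrullDim A ≤ d) :
    varietyDim Z ≤ d := by
  refine iSup_le fun l => ?_
  obtain ⟨x, hx⟩ := l.head.isIrreducible.nonempty
  obtain ⟨A, _, _, j, hA, hj, ⟨y, hy⟩, -⟩ := exists_affineOver Z (N := ⊤) (x := x) trivial
  have hemb := j.left.isOpenEmbedding
  have : Nontrivial A := PrimeSpectrum.nontrivial (p := y)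
  refine le_trans ?_ (h A j hA hj this)
  rw [← PrimeSpectrum.topologicalKrullDim_eq_ringKrullDim]
  let T := (TopologicalSpace.IrreducibleCloseds.orderIsoOfIsOpenEmbedding _ hemb).symm
    ⟨l.head, ⟨y, by simpa [hy] using hx⟩⟩
  have hT : TopologicalSpace.IrreducibleCloseds.map _ hemb.continuous T = l.head :=
    congrArg Subtype.val (OrderIso.apply_symm_apply
      (TopologicalSpace.IrreducibleCloseds.orderIsoOfIsOpenEmbedding _ hemb) _)
  calc (l.length : WithBot ℕ∞) ≤ Order.coheight l.head := by
        exact_mod_cast Order.length_le_coheight_head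
    _ = Order.coheight T := by rw [← hT, hemb.coheight_map]
    _ ≤ _ := Order.coheight_le_krullDim T

theorem exists_lift_over {S : Scheme.{u}} {U X T : Over S} (i : U ⟶ X) [IsOpenImmersion i.left]
    (f : T ⟶ X) (h : Set.range f.left ⊆ Set.range i.left) : ∃ g : T ⟶ U, g ≫ i = f := by
  have := IsOpenImmersion.lift_fac i.left f.left h
  refine ⟨Over.homMk (IsOpenImmersion.lift i.left f.left h) ?_, ?_⟩
  · rw [← Over.w i, reassoc_of% this, Over.w f]
  · ext1; exact this

theorem Over.mono_of_isOpenImmersion {S : Scheme.{u}} {U X : Over S} (i : U ⟶ X)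
    [IsOpenImmersion i.left] : Mono i :=
  Over.mono_of_mono_left i

theorem varietyDim_le_of_dominant {F K : Type u} [Field F] [Field K] [Algebra F K] [IsAlgClosed K]
    {W Z Z' : Over (Spec (CommRingCat.of F))} [IsIntegral W.left] [IsReduced Z.left]
    [LocallyOfFiniteType W.hom] [LocallyOfFiniteType Z.hom] [LocallyOfFiniteType Z'.hom]
    (g : W ⟶ Z) (g' : W ⟶ Z')
    (hg : ∀ N : Z.left.Opens, (N : Set Z.left).Nonempty → g.left (genericPoint W.left) ∈ N)
    (h : ∀ p q : specOver F K ⟶ W, p ≫ g' = q ≫ g' → p ≫ g = q ≫ g) :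
    varietyDim Z ≤ varietyDim Z' := by
  refine varietyDim_le fun A _ _ j hA hj _ => ?_
  obtain ⟨A', _, _, j', hA', hj', hxj', -⟩ :=
    exists_affineOver Z' (x := g'.left (genericPoint W.left)) (N := ⊤) trivial
  have : Nonempty (affineOver F A).left := inferInstanceAs (Nonempty (PrimeSpectrum A))
  have hxj : g.left (genericPoint W.left) ∈ j.left.opensRange := hg _ (Set.range_nonempty _)
  obtain ⟨B, _, _, k, hB, hk, ⟨y, hy⟩, hkN⟩ := exists_affineOver W (x := genericPoint W.left)
    (N := g.left ⁻¹ᵁ j.left.opensRange ⊓ g'.left ⁻¹ᵁ j'.left.opensRange) ⟨hxj, hxj'⟩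
  obtain ⟨f, hf⟩ := exists_lift_over j (k ≫ g) (by
    rintro _ ⟨x, rfl⟩; simpa using (hkN ⟨x, rfl⟩).1)
  obtain ⟨f', hf'⟩ := exists_lift_over j' (k ≫ g') (by
    rintro _ ⟨x, rfl⟩; simpa using (hkN ⟨x, rfl⟩).2)
  obtain ⟨φ, rfl⟩ := affineOverMap_surjective f
  obtain ⟨φ', rfl⟩ := affineOverMap_surjective f'
  have : Nonempty (Spec (CommRingCat.of B)) := ⟨y⟩
  have : IsDomain B := (affine_isIntegral_iff (.of B)).1 (isIntegral_of_isOpenImmersion k.left)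
  have : _root_.IsReduced A :=
    (affine_isReduced_iff (.of A)).1 (isReduced_of_isOpenImmersion j.left)
  have := Over.mono_of_isOpenImmersion j
  refine le_trans (ringKrullDim_le_of_forall_algHom F K φ ?_ φ' fun s t hst => ?_)
    (ringKrullDim_le_varietyDim j')
  · rw [injective_iff_map_eq_zero]
    intro a ha
    by_contra ha0
    -- As `A` is reduced, a ≠ 0 has a nonempty basic open set; it contains the image of the generic
    -- point, where φ a = 0 vanishes.
    have hne : (PrimeSpectrum.basicOpen a : Set (PrimeSpectrum A)).Nonempty := by
      rw [Set.nonempty_iff_ne_empty]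
      intro h0
      exact ha0 (PrimeSpectrum.basicOpen_eq_bot_iff a |>.1 (SetLike.coe_injective h0)).eq_zero
    obtain ⟨z, hz, hzy⟩ := hg (j.left ''ᵁ PrimeSpectrum.basicOpen a) (hne.image _)
    have hjy : j.left ((affineOverMap φ).left y) = j.left z := by
      refine Eq.trans ?_ hzy.symm
      rw [← hy, ← Scheme.Hom.comp_apply, ← Scheme.Hom.comp_apply, ← Over.comp_left,
        ← Over.comp_left, hf]
    have hyz := j.left.isOpenEmbedding.injective hjy
    rw [← hyz] at hz
    exact hz ((congrArg (· ∈ y.asIdeal) ha).mpr y.asIdeal.zero_mem)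
  · apply affineOverMap_injective
    let s' : specOver F K ⟶ affineOver F B := affineOverMap s
    let t' : specOver F K ⟶ affineOver F B := affineOverMap t
    have hst' : s' ≫ affineOverMap φ' = t' ≫ affineOverMap φ' :=
      (affineOverMap_comp φ' s).symm.trans
        ((congrArg affineOverMap hst).trans (affineOverMap_comp φ' t))
    have key := h (s' ≫ k) (t' ≫ k) (by
      rw [Category.assoc, Category.assoc, ← hf', reassoc_of% hst'])
    rw [Category.assoc, Category.assoc, ← hf, ← Category.assoc, ← Category.assoc,
      cancel_mono] at key
    exact (affineOverMap_comp φ s).trans (key.trans (affineOverMap_comp φ t).symm)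

theorem exists_specOver_mem {F : Type u} (K : Type u) [Field F] [Field K] [Algebra F K]
    [IsAlgClosed K] {Z : Over (Spec (CommRingCat.of F))} [LocallyOfFiniteType Z.hom]
    (N : Z.left.Opens) (hN : (N : Set Z.left).Nonempty) :
    ∃ p : specOver F K ⟶ Z, Set.range p.left ⊆ N := by
  obtain ⟨x, hx⟩ := hN
  obtain ⟨A, _, _, j, hA, hj, ⟨y, hy⟩, hjN⟩ := exists_affineOver Z hx
  have : Nontrivial A := PrimeSpectrum.nontrivial (p := y)
  obtain ⟨φ⟩ := Algebra.FiniteType.nonempty_algHom F K A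
  refine ⟨affineOverMap φ ≫ j, ?_⟩
  rintro _ ⟨t, rfl⟩
  exact hjN ⟨(affineOverMap φ).left t, (Scheme.Hom.comp_apply _ _ _).symm⟩

theorem genericPoint_mem_of_mem {X : Type*} [TopologicalSpace X] [QuasiSober X] [IrreducibleSpace X]
    {N : Set X} (hN : IsOpen N) {x : X} (hx : x ∈ N) : genericPoint X ∈ N :=
  (genericPoint_specializes x).mem_open hN hx

/-- Lifting K-points, without transition morphisms between the `W k`, is enough: K-points detect
whether the preimage of an open set is empty. -/
theorem varietyDim_le_of_sequence {F K : Type u} [Field F] [Field K] [Algebra F K] [IsAlgClosed K]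
    {W : ℕ → Over (Spec (CommRingCat.of F))} {Z Z' : Over (Spec (CommRingCat.of F))}
    [∀ k, IsIntegral (W k).left] [IsReduced Z.left] [∀ k, LocallyOfFiniteType (W k).hom]
    [LocallyOfFiniteType Z.hom] [LocallyOfFiniteType Z'.hom]
    (g : ∀ k, W k ⟶ Z) (g' : ∀ k, W k ⟶ Z')
    (hW : ∀ k (p : specOver F K ⟶ W k), ∃ q : specOver F K ⟶ W (k + 1), q ≫ g (k + 1) = p ≫ g k)
    (hg : ∀ N : Z.left.Opens, (N : Set Z.left).Nonempty → ∃ k, ∃ w, (g k).left w ∈ N)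
    (h : ∀ k, ∀ p q : specOver F K ⟶ W k, p ≫ g' k = q ≫ g' k → p ≫ g k = q ≫ g k) :
    varietyDim Z ≤ varietyDim Z' := by
  have : IsLocallyNoetherian Z.left := LocallyOfFiniteType.isLocallyNoetherian Z.hom
  have hmem (k) (N : Z.left.Opens) (w) (hw : (g k).left w ∈ N) :
      (g k).left (genericPoint (W k).left) ∈ N :=
    genericPoint_mem_of_mem ((g k).left ⁻¹ᵁ N).2 hw
  have hspec (k) : (g (k + 1)).left (genericPoint (W (k + 1)).left) ⤳
      (g k).left (genericPoint (W k).left) := by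
    rw [specializes_iff_forall_open]
    intro N hN hkN
    obtain ⟨p, hp⟩ := exists_specOver_mem K ((g k).left ⁻¹ᵁ ⟨N, hN⟩) ⟨_, hkN⟩
    obtain ⟨q, hq⟩ := hW k p
    let t : (specOver F K).left := (⊥ : PrimeSpectrum K)
    refine hmem (k + 1) ⟨N, hN⟩ (q.left t) ?_
    rw [← Scheme.Hom.comp_apply, ← Over.comp_left, hq]
    exact hp ⟨t, rfl⟩
  obtain ⟨n, hn⟩ := exists_forall_eq_of_specializes _ hspec
  refine varietyDim_le_of_dominant (K := K) (g n) (g' n) (fun N hN => ?_) (h n)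
  obtain ⟨k, w, hw⟩ := hg N hN
  have hk : ∀ m, k ≤ m → (g m).left (genericPoint (W m).left) ∈ N := fun m hm => by
    induction m, hm using Nat.le_induction with
    | base => exact hmem k N w hw
    | succ m _ ih => exact (hspec m).mem_open N.2 ih
  rw [← hn (max k n) (le_max_right _ _)]
  exact hk _ (le_max_left _ _)

theorem exists_inter_preimage {S : Scheme.{u}} {T V U U' : Over S} (f : T ⟶ V) (i : U ⟶ V)
    (i' : U' ⟶ V) [IsOpenImmersion i.left] [IsOpenImmersion i'.left] :
    ∃ (W : Over S) (j : W ⟶ T) (a : W ⟶ U) (a' : W ⟶ U'), IsOpenImmersion j.left ∧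
      a ≫ i = j ≫ f ∧ a' ≫ i' = j ≫ f ∧
      Set.range j.left = f.left ⁻¹' (Set.range i.left ∩ Set.range i'.left) := by
  let O := f.left ⁻¹ᵁ (i.left.opensRange ⊓ i'.left.opensRange)
  let j : Over.mk (O.ι ≫ T.hom) ⟶ T := Over.homMk O.ι rfl
  have hj : IsOpenImmersion j.left := inferInstanceAs (IsOpenImmersion O.ι)
  have hr : Set.range j.left = f.left ⁻¹' (Set.range i.left ∩ Set.range i'.left) :=
    O.range_ι
  have hr' (w) : j.left w ∈ f.left ⁻¹' (Set.range i.left ∩ Set.range i'.left) := hr ▸ ⟨w, rfl⟩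
  obtain ⟨a, ha⟩ := exists_lift_over i (j ≫ f) (by rintro _ ⟨w, rfl⟩; exact (hr' w).1)
  obtain ⟨a', ha'⟩ := exists_lift_over i' (j ≫ f) (by rintro _ ⟨w, rfl⟩; exact (hr' w).2)
  exact ⟨_, j, a, a', hj, ha, ha', hr⟩

/-! ### Points of ind-varieties and of their open ind-subvarieties. -/

namespace IndVariety

variable {F : Type u} [Field F] {K : Type u} [Field K] [Algebra F K]

theorem toPoint_map (X : IndVariety F) {n m : ℕ} (h : n ≤ m) (p : specOver F K ⟶ X.seq.obj n) :
    X.toPoint m (p ≫ X.seq.map (homOfLE h)) = X.toPoint n p :=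
  congr($(colimit.w (X.seq ⋙ coyoneda.obj (Opposite.op (specOver F K))) (homOfLE h)) p)

theorem exists_toPoint (X : IndVariety F) (x : X.Point K) :
    ∃ (n : ℕ) (p : specOver F K ⟶ X.seq.obj n), X.toPoint n p = x :=
  Types.jointly_surjective' (F := X.seq ⋙ coyoneda.obj (Opposite.op (specOver F K))) x

theorem mono_map (X : IndVariety F) {n m : ℕ} (h : n ≤ m) : Mono (X.seq.map (homOfLE h)) := by
  induction m, h using Nat.le_induction with
  | base => rw [Subsingleton.elim (homOfLE _) (𝟙 n), X.seq.map_id]; infer_instance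
  | succ m h ih =>
    have := X.isClosedImmersion m
    have : Mono (X.seq.map (homOfLE (Nat.le_succ m))) := Over.mono_of_mono_left _
    rw [← homOfLE_comp h (Nat.le_succ m), X.seq.map_comp]
    exact mono_comp _ _

theorem toPoint_injective (X : IndVariety F) (n : ℕ) :
    Function.Injective (X.toPoint n : (specOver F K ⟶ X.seq.obj n) → X.Point K) := by
  intro p q hpq
  obtain ⟨m, f, g, h⟩ := (Types.FilteredColimit.colimit_eq_iff
    (X.seq ⋙ coyoneda.obj (Opposite.op (specOver F K)))).1 hpq
  have := X.mono_map f.le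
  obtain rfl := Subsingleton.elim f g
  exact (cancel_mono (X.seq.map (homOfLE f.le))).1 h

theorem IsIndMorphism.exists_monotone {X Y : IndVariety F} {φ : X.Point K → Y.Point K}
    (h : IsIndMorphism φ) :
    ∃ M : ℕ → ℕ, Monotone M ∧ (∀ k, k ≤ M k) ∧ ∃ f : ∀ k, X.seq.obj k ⟶ Y.seq.obj (M k),
      ∀ k (p : specOver F K ⟶ X.seq.obj k), φ (X.toPoint k p) = Y.toPoint (M k) (p ≫ f k) := by
  choose N f hf using h
  have hN (k) : N k ≤ k + ∑ i ∈ Finset.range (k + 1), N i :=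
    (Finset.single_le_sum (fun i _ => Nat.zero_le (N i)) (Finset.self_mem_range_succ k)).trans
      (Nat.le_add_left _ _)
  -- The sum makes the index monotone and at least `N k`; the summand k makes it at least k.
  refine ⟨fun k => k + ∑ i ∈ Finset.range (k + 1), N i, ?_, fun k => Nat.le_add_right _ _,
    fun k => f k ≫ Y.seq.map (homOfLE (hN k)), fun k p => ?_⟩
  · intro a b hab
    have := Finset.sum_le_sum_of_subset (f := N) (Finset.range_mono (Nat.succ_le_succ hab))
    exact Nat.add_le_add hab this
  · rw [← Category.assoc, toPoint_map, hf]

theorem HomTo.map_app {U : IndVariety F} {Z : Over (Spec (CommRingCat.of F))} (π : HomTo U Z)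
    {n m : ℕ} (h : n ≤ m) :
    (U.seq.map (homOfLE h) ≫ π.app m : U.seq.obj n ⟶ Z) = π.app n :=
  (π.naturality (homOfLE h)).trans (Category.comp_id _)

variable {X : IndVariety F}

theorem OpenIndSubvariety.mono_incl (U : OpenIndSubvariety X) (n : ℕ) : Mono (U.incl.app n) :=
  have := U.isOpenImmersion n
  Over.mono_of_isOpenImmersion _

theorem OpenIndSubvariety.toPoint_incl_map (U : OpenIndSubvariety X) {n m : ℕ} (h : n ≤ m)
    (p : specOver F K ⟶ U.seq.obj n) :
    X.toPoint m ((p ≫ U.seq.map (homOfLE h)) ≫ U.incl.app m) = X.toPoint n (p ≫ U.incl.app n) := by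
  rw [Category.assoc, U.incl.naturality, ← Category.assoc, toPoint_map]

/-- The value of π at a point of X(K) does not depend on the level or the lift chosen, as U_m(K) →
X(K) is injective. -/
theorem comp_app_eq_of_mem_fiber {U : OpenIndSubvariety X} {Z : Over (Spec (CommRingCat.of F))}
    (π : HomTo U.toIndVariety Z) {z : specOver F K ⟶ Z} {n : ℕ} {p : specOver F K ⟶ U.seq.obj n}
    (h : X.toPoint n (p ≫ U.incl.app n) ∈ fiber π z) : p ≫ π.app n = z := by
  obtain ⟨m, q, rfl, hq⟩ := h
  rw [← U.toPoint_incl_map (le_max_left n m), ← U.toPoint_incl_map (le_max_right n m)] at hq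
  have := U.mono_incl (max n m)
  have hpq := (cancel_mono _).1 (X.toPoint_injective _ hq)
  rw [← HomTo.map_app π (le_max_left n m), ← HomTo.map_app π (le_max_right n m),
    ← Category.assoc, ← Category.assoc, hpq]

end IndVariety

/-! ### Comparison of two quotient maps. -/

namespace IndVariety

variable {F : Type u} [Field F] {K : Type u} [Field K] [Algebra F K] {X : IndVariety F}

theorem FibersAreOrbits.comp_app_eq {G : IndVariety F} [Group (G.Point K)]
    [MulAction (G.Point K) (X.Point K)] {U U' : OpenIndSubvariety X}
    {Z Z' : Over (Spec (CommRingCat.of F))} {π : HomTo U.toIndVariety Z}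
    {π' : HomTo U'.toIndVariety Z'} (h : FibersAreOrbits K G π) (h' : FibersAreOrbits K G π')
    {m : ℕ} {p q : specOver F K ⟶ U.seq.obj m} {p' q' : specOver F K ⟶ U'.seq.obj m}
    (hp : p ≫ U.incl.app m = p' ≫ U'.incl.app m) (hq : q ≫ U.incl.app m = q' ≫ U'.incl.app m)
    (hpq : p' ≫ π'.app m = q' ≫ π'.app m) : p ≫ π.app m = q ≫ π.app m := by
  obtain ⟨y, hy⟩ := h (p ≫ π.app m)
  obtain ⟨y', hy'⟩ := h' (p' ≫ π'.app m)
  have h1 : X.toPoint m (p ≫ U.incl.app m) ∈ fiber π (p ≫ π.app m) := ⟨m, p, rfl, rfl⟩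
  have h1' : X.toPoint m (p ≫ U.incl.app m) ∈ fiber π' (p' ≫ π'.app m) :=
    ⟨m, p', rfl, by rw [hp]⟩
  have h2' : X.toPoint m (q ≫ U.incl.app m) ∈ fiber π' (p' ≫ π'.app m) :=
    ⟨m, q', hpq.symm, by rw [hq]⟩
  refine (comp_app_eq_of_mem_fiber π ?_).symm
  rw [hy] at h1 ⊢
  rw [hy'] at h1' h2'
  rwa [← MulAction.orbit_eq_iff.2 h1, MulAction.orbit_eq_iff.2 h1']

theorem FibersAreOrbits.varietyDim_le [IsAlgClosed K] {G : IndVariety F} [Group (G.Point K)]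
    [MulAction (G.Point K) (X.Point K)] (hX : IsIrreducible K X) {U U' : OpenIndSubvariety X}
    {Z Z' : Over (Spec (CommRingCat.of F))} {π : HomTo U.toIndVariety Z}
    {π' : HomTo U'.toIndVariety Z'} (hU : Nonempty (U.toIndVariety.Point K))
    (hU' : Nonempty (U'.toIndVariety.Point K)) (hZ : IsVariety Z) (hZ' : IsVariety Z')
    (h : FibersAreOrbits K G π) (h' : FibersAreOrbits K G π') : varietyDim Z ≤ varietyDim Z' := by
  obtain ⟨Y, ⟨e, -, he⟩, hY⟩ := hX
  obtain ⟨M, hM, hkM, f, hf⟩ := he.exists_monotone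
  have := hZ.isReduced
  have := hZ.locallyOfFiniteType
  have := hZ'.locallyOfFiniteType
  have := U.isOpenImmersion
  have := U'.isOpenImmersion
  choose W j a a' hj ha ha' hW using fun k =>
    exists_inter_preimage (f k) (U.incl.app (M k)) (U'.incl.app (M k))
  let g (k) : W k ⟶ Z := a k ≫ π.app (M k)
  let g' (k) : W k ⟶ Z' := a' k ≫ π'.app (M k)
  -- a point of `U` eventually comes from the `Y k`
  have hpoint (U₀ : OpenIndSubvariety X) (m : ℕ) (p : specOver F K ⟶ U₀.seq.obj m) :
      ∃ n, ∀ k, n ≤ k → ∃ (hmk : m ≤ M k) (q : specOver F K ⟶ Y.seq.obj k),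
        q ≫ f k = (p ≫ U₀.seq.map (homOfLE hmk)) ≫ U₀.incl.app (M k) := by
    obtain ⟨n, q, hq⟩ := Y.exists_toPoint (e (X.toPoint m (p ≫ U₀.incl.app m)))
    refine ⟨max n m, fun k hk => ?_⟩
    have hmk : m ≤ M k := (le_max_right n m).trans (hk.trans (hkM k))
    refine ⟨hmk, q ≫ Y.seq.map (homOfLE ((le_max_left n m).trans hk)),
      X.toPoint_injective (M k) ?_⟩
    rw [← hf, toPoint_map, hq, U₀.toPoint_incl_map, Equiv.symm_apply_apply]
  have hstep (k) (p : specOver F K ⟶ W k) :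
      ∃ q : specOver F K ⟶ W (k + 1), q ≫ g (k + 1) = p ≫ g k := by
    have hle := hM (Nat.le_add_right k 1)
    have hlift (U₀ : OpenIndSubvariety X) (b : W k ⟶ U₀.seq.obj (M k))
        (hb : b ≫ U₀.incl.app (M k) = j k ≫ f k) :
        ((p ≫ b) ≫ U₀.seq.map (homOfLE hle)) ≫ U₀.incl.app (M (k + 1)) =
          ((p ≫ j k) ≫ Y.seq.map (homOfLE (Nat.le_add_right k 1))) ≫ f (k + 1) := by
      apply X.toPoint_injective
      rw [U₀.toPoint_incl_map, ← hf, toPoint_map, hf, Category.assoc, Category.assoc, hb]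
    obtain ⟨q, hq⟩ := exists_lift_over (j (k + 1))
      ((p ≫ j k) ≫ Y.seq.map (homOfLE (Nat.le_add_right k 1))) (by
        rintro _ ⟨t, rfl⟩
        rw [hW]
        exact ⟨⟨_, congr($(congrArg Over.Hom.left (hlift U (a k) (ha k))) t)⟩,
          ⟨_, congr($(congrArg Over.Hom.left (hlift U' (a' k) (ha' k))) t)⟩⟩)
    have hqa : q ≫ a (k + 1) = (p ≫ a k) ≫ U.seq.map (homOfLE hle) := by
      have := U.mono_incl (M (k + 1))
      rw [← cancel_mono (U.incl.app (M (k + 1))), hlift U (a k) (ha k), ← hq, Category.assoc,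
        Category.assoc, ha]
    refine ⟨q, ?_⟩
    calc q ≫ g (k + 1) = (q ≫ a (k + 1)) ≫ (π.app (M (k + 1)) : _ ⟶ Z) :=
          (Category.assoc _ _ _).symm
      _ = (p ≫ a k) ≫ U.seq.map (homOfLE hle) ≫ (π.app (M (k + 1)) : _ ⟶ Z) := by
          rw [hqa]; exact Category.assoc _ _ _
      _ = p ≫ g k := by rw [HomTo.map_app π hle]; exact Category.assoc _ _ _
  obtain ⟨u'⟩ := hU'
  obtain ⟨m', p', -⟩ := U'.toIndVariety.exists_toPoint u'
  obtain ⟨n', hn'⟩ := hpoint U' m' p'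
  have hg (N : Z.left.Opens) (hN : (N : Set Z.left).Nonempty) :
      ∃ n, ∀ k, n ≤ k → ∃ w, (g k).left w ∈ N := by
    obtain ⟨z, hz⟩ := exists_specOver_mem K N hN
    obtain ⟨x, hx⟩ := h z
    obtain ⟨m, p, hpz, -⟩ : x ∈ fiber π z := hx ▸ MulAction.mem_orbit_self x
    obtain ⟨n, hn⟩ := hpoint U m p
    refine ⟨max n n', fun k hk => ?_⟩
    obtain ⟨hmk, q, hq⟩ := hn k ((le_max_left _ _).trans hk)
    obtain ⟨hmk', q', hq'⟩ := hn' k ((le_max_right _ _).trans hk)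
    let t : (specOver F K).left := (⊥ : PrimeSpectrum K)
    let πk : U.seq.obj (M k) ⟶ Z := π.app (M k)
    -- The preimages of π⁻¹(N) and of U' are nonempty for large k, so they meet in the irreducible
    -- Y_k, and the common point lies in W_k.
    let V : (Y.seq.obj k).left.Opens :=
      (f k).left ⁻¹ᵁ ((U.incl.app (M k)).left ''ᵁ (πk.left ⁻¹ᵁ N))
    let V' : (Y.seq.obj k).left.Opens := (f k).left ⁻¹ᵁ (U'.incl.app (M k)).left.opensRange
    have hV : q.left t ∈ V := by
      refine ⟨(p ≫ U.seq.map (homOfLE hmk)).left t, ?_, ?_⟩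
      · have : (p ≫ U.seq.map (homOfLE hmk)) ≫ πk = z := by
          rw [Category.assoc, HomTo.map_app π hmk, hpz]
        refine hz ⟨t, ?_⟩
        rw [← this]
        exact Scheme.Hom.comp_apply _ _ _
      · exact congr($(congrArg Over.Hom.left hq.symm) t)
    have hV' : q'.left t ∈ V' :=
      ⟨(p' ≫ U'.seq.map (homOfLE hmk')).left t, congr($(congrArg Over.Hom.left hq'.symm) t)⟩
    have := hY k
    obtain ⟨y, ⟨s, hs, hsy⟩, hy'⟩ :=
      nonempty_preirreducible_inter V.2 V'.2 ⟨_, hV⟩ ⟨_, hV'⟩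
    obtain ⟨w, hw⟩ : y ∈ Set.range (j k).left := (hW k).symm ▸ ⟨⟨s, hsy⟩, hy'⟩
    refine ⟨w, ?_⟩
    have haw : (a k).left w = s := by
      apply (U.incl.app (M k)).left.isOpenEmbedding.injective
      refine Eq.trans ?_ hsy.symm
      rw [← hw]
      exact congr($(congrArg Over.Hom.left (ha k)) w)
    rw [← haw] at hs
    exact hs
  obtain ⟨u⟩ := hU
  obtain ⟨m, p, -⟩ := U.toIndVariety.exists_toPoint u
  have hZne : ((⊤ : Z.left.Opens) : Set Z.left).Nonempty :=
    ⟨(p ≫ π.app m : specOver F K ⟶ Z).left (⊥ : PrimeSpectrum K), trivial⟩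
  -- Early W_k may be empty; from n₀ on they are nonempty, hence integral, so the sequence is
  -- shifted by n₀.
  obtain ⟨n₀, hn₀⟩ := hg ⊤ hZne
  have hint (k) : IsIntegral (W (n₀ + k)).left := by
    have := hY (n₀ + k)
    have := (Y.isVariety (n₀ + k)).isReduced
    have := isIntegral_of_irreducibleSpace_of_isReduced (Y.seq.obj (n₀ + k)).left
    have : Nonempty (W (n₀ + k)).left := ⟨(hn₀ _ (Nat.le_add_right _ _)).choose⟩
    exact isIntegral_of_isOpenImmersion (j (n₀ + k)).left
  have hft (k) : LocallyOfFiniteType (W (n₀ + k)).hom := by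
    have := (Y.isVariety (n₀ + k)).locallyOfFiniteType
    rw [← Over.w (j (n₀ + k))]
    infer_instance
  refine varietyDim_le_of_sequence (K := K) (W := fun k => W (n₀ + k)) (fun k => g (n₀ + k))
    (fun k => g' (n₀ + k)) (fun k p => ?_) (fun N hN => ?_) (fun k p q hpq => ?_)
  · exact hstep (n₀ + k) p
  · obtain ⟨n, hn⟩ := hg N hN
    exact ⟨n, hn _ (Nat.le_add_left _ _)⟩
  · have h1 (p : specOver F K ⟶ W (n₀ + k)) : (p ≫ a (n₀ + k)) ≫ U.incl.app _ =
        (p ≫ a' (n₀ + k)) ≫ U'.incl.app _ := by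
      rw [Category.assoc, Category.assoc, ha, ha']
    exact (Category.assoc _ _ _).symm.trans ((h.comp_app_eq h' (h1 p) (h1 q)
      (((Category.assoc _ _ _).trans hpq).trans (Category.assoc _ _ _).symm)).trans
        (Category.assoc _ _ _))

end IndVariety

theorem mainTheorem5 (F K : Type u) [Field F] [Field K] [Algebra F K] [IsAlgClosed K]
    (G X : IndVariety F) [Group (G.Point K)] (hG : IndVariety.IsIndGroup K G)
    (hX : IndVariety.IsIrreducible K X)
    [MulAction (G.Point K) (X.Point K)] (hact : IndVariety.IsRegularAction K G X) :
    (∀ (U U' : IndVariety.OpenIndSubvariety X) (Z Z' : Over (Spec (CommRingCat.of F)))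
        (π : IndVariety.HomTo U.toIndVariety Z) (π' : IndVariety.HomTo U'.toIndVariety Z'),
        Nonempty (U.toIndVariety.Point K) → Nonempty (U'.toIndVariety.Point K) →
        IsVariety Z → IsVariety Z' →
        IndVariety.FibersAreOrbits K G π → IndVariety.FibersAreOrbits K G π' →
        varietyDim Z = varietyDim Z') ∧
      ∀ k k' : ℕ, IndVariety.HasGenericModality K G X k →
        IndVariety.HasGenericModality K G X k' → k = k' := by
  have key : ∀ (U U' : IndVariety.OpenIndSubvariety X) (Z Z' : Over (Spec (CommRingCat.of F)))
      (π : IndVariety.HomTo U.toIndVariety Z) (π' : IndVariety.HomTo U'.toIndVariety Z'),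
      Nonempty (U.toIndVariety.Point K) → Nonempty (U'.toIndVariety.Point K) →
      IsVariety Z → IsVariety Z' →
      IndVariety.FibersAreOrbits K G π → IndVariety.FibersAreOrbits K G π' →
      varietyDim Z = varietyDim Z' := fun U U' Z Z' π π' hU hU' hZ hZ' h h' =>
    le_antisymm (h.varietyDim_le hX hU hU' hZ hZ' h') (h'.varietyDim_le hX hU' hU hZ' hZ h)
  have hne (U : IndVariety.OpenIndSubvariety X) (Z : Over (Spec (CommRingCat.of F)))
      (π : IndVariety.HomTo U.toIndVariety Z) (k : ℕ) (hZ : IsVariety Z) (hk : varietyDim Z = k)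
      (h : IndVariety.FibersAreOrbits K G π) : Nonempty (U.toIndVariety.Point K) := by
    have := hZ.locallyOfFiniteType
    -- The empty variety has dimension ⊥, which is not a natural number.
    have hZne : Nonempty Z.left := by
      by_contra hn
      rw [not_nonempty_iff] at hn
      have : IsEmpty (TopologicalSpace.IrreducibleCloseds Z.left) :=
        ⟨fun T => hn.elim T.isIrreducible.nonempty.some⟩
      have hbot : varietyDim Z = ⊥ := Order.krullDim_eq_bot
      rw [hk] at hbot
      exact WithBot.coe_ne_bot hbot
    obtain ⟨z, -⟩ := exists_specOver_mem K (⊤ : Z.left.Opens) ⟨hZne.some, trivial⟩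
    obtain ⟨x, hx⟩ := h z
    obtain ⟨m, p, -⟩ : x ∈ IndVariety.fiber π z := hx ▸ MulAction.mem_orbit_self x
    exact ⟨U.toPoint m p⟩
  refine ⟨key, ?_⟩
  rintro k k' ⟨U, Z, π, hZ, hk, h⟩ ⟨U', Z', π', hZ', hk', h'⟩
  have := key U U' Z Z' π π' (hne U Z π k hZ hk h) (hne U' Z' π' k' hZ' hk' h') hZ hZ' h h'
  rw [hk, hk'] at this
  exact_mod_cast this
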